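/- **Setting.** There are $m$ disjoint communities; community $C_i$ has $d_i\ge 1$ members, and $\mu_i=1/d_i$. A budget $K>m$ is given; put $K'=K-m+1$. A realization $\phi$ maps each pair $(i,\tau)\in[m]\times[K]$ to a member $\phi(i,\tau)\in C_i$, the member met in the $\tau$-th exploration of $C_i$. In a random realization $\Phi$ all the $\Phi(i,\tau)$ are independent, and $\Phi(i,\tau)$ is uniform on $C_i$. For $\boldsymbol k\in\mathbb{N}^m$ with $\sum_i k_i\le K$ the reward $R(\boldsymbol k,\phi)=\sum_i|\{\phi(i,1),\dots,\phi(i,k_i)\}|$ is the number of distinct members met, $r_{\boldsymbol k}=\mathbb{E}_\Phi[R(\boldsymbol k,\Phi)]$, and $\boldsymbol k^*$ is a maximizer of $r_{\boldsymbol k}$ over all $\boldsymbol k$ with $\sum_i k_i\le K$. For $\boldsymbol k$ with $\sum_i k_i=K$ let $\Delta_{\boldsymbol k}=r_{\boldsymbol k^*}-r_{\boldsymbol k}$. For each $i$ let $\Delta^i_{\min}$ and $\Delta^i_{\max}$ be the minimum and the maximum of $\Delta_{\boldsymbol k}$ over all $\boldsymbol k$ with $\sum_j k_j=K$, $\Delta_{\boldsymbol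 k}>0$ and $k_i>1$ (if there is no such $\boldsymbol k$, then $\Delta^i_{\min}=\infty$ and $\Delta^i_{\max}=0$). Let $\Delta_{\max}=\max_i\Delta^i_{\max}$. **Revised CLCB algorithm (non-adaptive exploration).** Let $\Phi_1,\Phi_2,\dots$ be independent random realizations. Start with $T_i=0$ and $\hat\mu_i=0$ for all $i$. In round $t=1,2,\dots$: 1. For each $i$ put $\rho_i=\sqrt{3\ln t/(2T_i)}$ (with $\rho_i=0$ if $T_i=0$) and $\underline{\mu}_i=\max\{0,\hat\mu_i-\rho_i\}$. 2. Choose $\boldsymbol k_t$ by the greedy method: start with $\boldsymbol k=0$ and, $K$ times, increase $k_{i}$ by one for some $i\in\arg\max_j(1-\underline{\mu}_j)^{k_j}$. Ties may be broken by any rule, possibly randomized, that does not depend on $\Phi_t,\Phi_{t+1},\dots$ and under which every community is explored at least once in the round, i.e. $k_{i,t}\ge 1$ for all $i$. 3. Explore each $C_i$ for $k_{i,t}$ times and meet $u_x=\Phi_t(i,x)$, $1\le x\le k_{i,t}$. For each $i$ with $k_{i,t}>1$ let $X_{i,t}=\frac{1}{\lfloor k_{i,t}/2\rfloor}\sum_{x=1}^{\lfloor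 k_{i,t}/2\rfloor}\mathbf 1\{u_{2x-1}=u_{2x}\}$, and update $T_i\leftarrow T_i+1$ and then $\hat\mu_i\leftarrow\hat\mu_i+(X_{i,t}-\hat\mu_i)/T_i$. The regret is $\mathrm{Reg}^r(T)=\mathbb{E}\left[\sum_{t=1}^T\left(R(\boldsymbol k^*,\Phi_t)-R(\boldsymbol k_t,\Phi_t)\right)\right]$. **Theorem.** For every $T\ge 1$, $$\mathrm{Reg}^r(T)\le\sum_{i=1}^m\frac{48\binom{K'}{2}^2\ln T}{\Delta^i_{\min}}+2\binom{K'}{2}m+\frac{\pi^2}{3}\,m\,\Delta_{\max},$$ where a summand with $\Delta^i_{\min}=\infty$ is $0$. -/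

import Mathlib

open MeasureTheory ProbabilityTheory

noncomputable section

namespace CommunityExploration

/-- A realization of the explorations of one round: community `i` has the members `Fin (d i)`, and
`φ i τ` is the member met in the exploration number `τ + 1` of community `i`. -/
abbrev Realization {m : ℕ} (K : ℕ) (d : Fin m → ℕ) : Type :=
  (i : Fin m) → Fin K → Fin (d i)

/-- The law of a random realization: all the members met are independent, and those met in
community `i` are uniform on `Fin (d i)`. -/
def realizationLaw {m : ℕ} (K : ℕ) (d : Fin m → ℕ) : Measure (Realization K d) :=
  Measure.pi fun i => Measure.pi fun _ : Fin K => (uniformOn Set.univ : Measure (Fin (d i)))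

/-- The sequences of members met in each community when community `i` is explored `k i` times. -/
def feedback {m K : ℕ} {d : Fin m → ℕ} (k : Fin m → ℕ) (φ : Realization K d) (i : Fin m) :
    List (Fin (d i)) :=
  (List.ofFn (φ i)).take (k i)

/-- The number of distinct members met. -/
def reward {m K : ℕ} {d : Fin m → ℕ} (k : Fin m → ℕ) (φ : Realization K d) : ℕ :=
  ∑ i, (feedback k φ i).toFinset.card

/-- The expected reward of a budget allocation. -/
def expectedReward {m : ℕ} (K : ℕ) (d : Fin m → ℕ) (k : Fin m → ℕ) : ℝ :=
  ∫ φ, (reward k φ : ℝ) ∂(realizationLaw K d)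

/-- `k` maximizes the expected reward among the allocations of total budget at most `K`. -/
def IsOptimalAllocation {m : ℕ} (K : ℕ) (d : Fin m → ℕ) (k : Fin m → ℕ) : Prop :=
  ∑ i, k i ≤ K ∧
    ∀ k' : Fin m → ℕ, ∑ i, k' i ≤ K → expectedReward K d k' ≤ expectedReward K d k

/-- The gap of the action `k` with respect to the optimal allocation `kstar`. -/
def gap {m : ℕ} (K : ℕ) (d : Fin m → ℕ) (kstar k : Fin m → ℕ) : ℝ :=
  expectedReward K d kstar - expectedReward K d k

/-- The actions of total budget `K` with positive gap which explore community `i` more than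
once. -/
def badActions {m : ℕ} (K : ℕ) (d : Fin m → ℕ) (kstar : Fin m → ℕ) (i : Fin m) :
    Set (Fin m → ℕ) :=
  {k | ∑ j, k j = K ∧ 0 < gap K d kstar k ∧ 1 < k i}

/-- The smallest gap of a bad action of community `i`; it is `⊤` if there is none. -/
def gapMin {m : ℕ} (K : ℕ) (d : Fin m → ℕ) (kstar : Fin m → ℕ) (i : Fin m) : EReal :=
  ⨅ k ∈ badActions K d kstar i, ((gap K d kstar k : ℝ) : EReal)

/-- The largest gap of a bad action of community `i` (there are finitely many bad actions); it is
`0` if there is none. -/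
def gapMaxAt {m : ℕ} (K : ℕ) (d : Fin m → ℕ) (kstar : Fin m → ℕ) (i : Fin m) : ℝ :=
  sSup (gap K d kstar '' badActions K d kstar i)

/-- The largest of the numbers `gapMaxAt K d kstar i`. -/
def gapMax {m : ℕ} (K : ℕ) (d : Fin m → ℕ) (kstar : Fin m → ℕ) : ℝ :=
  ⨆ i, gapMaxAt K d kstar i

/-- `GreedyAllocation μ s k`: the greedy method run for `s` steps with the parameters `μ` can
return the allocation `k`. Each step gives one more exploration to some community `i` that
maximizes `(1 - μ i) ^ k i`; any tie-breaking is allowed. -/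
inductive GreedyAllocation {m : ℕ} (μ : Fin m → ℝ) : ℕ → (Fin m → ℕ) → Prop
  | zero : GreedyAllocation μ 0 (fun _ => 0)
  | step {s : ℕ} {k : Fin m → ℕ} {i : Fin m} (h : GreedyAllocation μ s k)
      (hi : ∀ j, (1 - μ j) ^ k j ≤ (1 - μ i) ^ k i) :
      GreedyAllocation μ (s + 1) (Function.update k i (k i + 1))

/-- The fraction of collisions among the `⌊|S| / 2⌋` disjoint consecutive pairs of `S`. -/
def collisionAverage {α : Type*} [DecidableEq α] (S : List α) : ℝ :=
  (∑ x ∈ Finset.range (S.length / 2), if S[2 * x]? = S[2 * x + 1]? then (1 : ℝ) else 0) /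
    ((S.length / 2 : ℕ) : ℝ)

/-- The memory of the learner: for each community the number of observations and the empirical
mean. -/
structure LearnerState (m : ℕ) where
  count : Fin m → ℕ
  mean : Fin m → ℝ

/-- The initial memory. -/
def LearnerState.init (m : ℕ) : LearnerState m where
  count := fun _ => 0
  mean := fun _ => 0

/-- The update of the revised algorithm: one averaged observation for each community in which at
least two members were met. -/
def LearnerState.update {m : ℕ} {d : Fin m → ℕ} (σ : LearnerState m)
    (S : (i : Fin m) → List (Fin (d i))) : LearnerState m where
  count := fun i => σ.count i + if 1 < (S i).length then 1 else 0
  mean := fun i =>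
    if 1 < (S i).length then
      σ.mean i + (collisionAverage (S i) - σ.mean i) / ((σ.count i + 1 : ℕ) : ℝ)
    else σ.mean i

/-- The confidence radius used in round `t`. -/
def LearnerState.radius {m : ℕ} (σ : LearnerState m) (t : ℕ) (i : Fin m) : ℝ :=
  if σ.count i = 0 then 0 else Real.sqrt (3 * Real.log t / (2 * σ.count i))

/-- The lower confidence bound used in round `t`. -/
def LearnerState.lcb {m : ℕ} (σ : LearnerState m) (t : ℕ) (i : Fin m) : ℝ :=
  max 0 (σ.mean i - σ.radius t i)

/-- The memory at the end of round `t`, when the rounds `1, 2, …` are played with the allocations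
`k 1, k 2, …` and the realizations `φ 1, φ 2, …`. -/
def stateAfter {m K : ℕ} {d : Fin m → ℕ} (k : ℕ → Fin m → ℕ) (φ : ℕ → Realization K d) :
    ℕ → LearnerState m
  | 0 => LearnerState.init m
  | t + 1 => (stateAfter k φ t).update (feedback (k (t + 1)) (φ (t + 1)))

/-- The online environment: `ℱ t` is the information available at the end of round `t` (it may
include the internal randomness of the learner), the realization `Φ (t + 1)` of round `t + 1` is
revealed in that round, is independent of the past, and has the law `realizationLaw K d`. -/
structure IsOnlineEnvironment {m K : ℕ} (d : Fin m → ℕ) {Ω : Type*} {mΩ : MeasurableSpace Ω}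
    (P : Measure Ω) (ℱ : Filtration ℕ mΩ) (Φ : ℕ → Ω → Realization K d) : Prop where
  adapted : ∀ t, Measurable[ℱ (t + 1)] (Φ (t + 1))
  indep : ∀ t, Indep (ℱ t) (MeasurableSpace.comap (Φ (t + 1)) inferInstance) P
  law : ∀ t, P.map (Φ (t + 1)) = realizationLaw K d

/-- The allocations `k 1, k 2, …` are chosen by the revised CLCB algorithm with the non-adaptive
exploration method. The ties in the greedy method are broken by any rule, possibly randomized, that
does not look at the future and lets every community be explored at least once in each round. -/
structure IsRevisedCLCB {m K : ℕ} {d : Fin m → ℕ} {Ω : Type*} {mΩ : MeasurableSpace Ω}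
    (ℱ : Filtration ℕ mΩ) (Φ : ℕ → Ω → Realization K d) (k : ℕ → Ω → Fin m → ℕ) : Prop where
  nonanticipating : ∀ t, Measurable[ℱ t] (k (t + 1))
  greedy : ∀ t ω,
    GreedyAllocation ((stateAfter (fun s => k s ω) (fun s => Φ s ω) t).lcb (t + 1)) K (k (t + 1) ω)
  explores : ∀ t ω i, 1 ≤ k (t + 1) ω i

/-- The regret of the allocations `k 1, …, k T` with respect to the optimal allocation `kstar`. -/
def regret {m K : ℕ} {d : Fin m → ℕ} {Ω : Type*} {mΩ : MeasurableSpace Ω} (P : Measure Ω)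
    (Φ : ℕ → Ω → Realization K d) (kstar : Fin m → ℕ) (k : ℕ → Ω → Fin m → ℕ) (T : ℕ) : ℝ :=
  ∫ ω, ∑ t ∈ Finset.Icc 1 T,
    ((reward kstar (Φ t ω) : ℝ) - (reward (k t ω) (Φ t ω) : ℝ)) ∂P

end CommunityExploration

end

/-!
A community of size `d` contributes `∑ j < n, (1 - 1 / d) ^ j` to the expected reward of `n`
explorations. Replacing each `1 / d i` by a lower confidence bound only increases the value of
every allocation, and by complementary slackness the greedy allocation `k` maximizes that larger
value. As long as the confidence bounds are valid, the gap of `k` is therefore at most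
`∑ i, (k i).choose 2 * w i`, where `w i` is the width of the confidence interval.

The observations of one community are averages of indicators of collisions between disjoint pairs,
hence lie in `[0, 1]` and have conditional mean `1 / d i` even though `k` depends on the past.
Hoeffding's exponential supermartingale and a union bound over the number of observations show that
the bounds of round `t` fail with probability at most `2 m / t ^ 2`; these rounds cost at most
`π ^ 2 / 3 * m * gapMax`.

In the other rounds, with `B = (K - m + 1).choose 2 ≥ ∑ i, (k i).choose 2`, a gap `Δ > 0` satisfies
`Δ ≤ ∑ i, max 0 (2 * B * w i - Δ)` over the communities explored more than once. Each term is
decreasing in `Δ ≥ gapMin i`, and each such round adds an observation, so the terms of community `i`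
sum to at most `∑ n, max 0 (2 * B * √(6 log T / n) - gapMin i) ≤ 24 * B ^ 2 * log T / gapMin i`,
plus `2 * B` for the first observation, made with the trivial width `1`.
-/

namespace CommunityExploration

section IIDSamples

variable {ι α : Type*} [Fintype ι] [MeasurableSpace α] [MeasurableSingletonClass α]
  {ν : Measure α} [IsProbabilityMeasure ν]

theorem measureReal_pi_forall_ne (s : Finset ι) (v : α) :
    (Measure.pi fun _ : ι => ν).real {f | ∀ j ∈ s, f j ≠ v} = (1 - ν.real {v}) ^ s.card := by
  rw [show {f : ι → α | ∀ j ∈ s, f j ≠ v} = (s : Set ι).pi fun _ => {v}ᶜ from rfl,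
    measureReal_def, Measure.pi_pi_finset, Finset.prod_const, ENNReal.toReal_pow,
    ← measureReal_def, probReal_compl_eq_one_sub (measurableSet_singleton v)]

variable [Fintype α]

theorem measureReal_pi_collision {a b : ι} (hab : a ≠ b) :
    (Measure.pi fun _ : ι => ν).real {f | f a = f b} = ∑ v, ν.real {v} ^ 2 := by
  classical
  have hunion : {f : ι → α | f a = f b} =
      ⋃ v, (({a, b} : Finset ι) : Set ι).pi fun _ => {v} := by
    ext f
    simp [eq_comm]
  have hdisj : Pairwise (Function.onFun Disjoint fun v : α =>
      (({a, b} : Finset ι) : Set ι).pi fun _ => ({v} : Set α)) := by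
    refine fun v w hvw => Set.disjoint_left.2 fun f hv hw => hvw ?_
    rw [← (hv a (by simp) : f a = v), (hw a (by simp) : f a = w)]
  rw [hunion, measureReal_iUnion_fintype hdisj fun _ => MeasurableSet.of_discrete]
  refine Finset.sum_congr rfl fun v _ => ?_
  rw [measureReal_def, Measure.pi_pi_finset, Finset.prod_pair hab, ENNReal.toReal_mul, sq,
    measureReal_def]

theorem integral_card_image [DecidableEq α] (s : Finset ι) :
    ∫ f, ((s.image f).card : ℝ) ∂(Measure.pi fun _ : ι => ν) =
      ∑ v, (1 - (1 - ν.real {v}) ^ s.card) := by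
  have hcard : ∀ f : ι → α, ((s.image f).card : ℝ) =
      ∑ v, {g : ι → α | ∀ j ∈ s, g j ≠ v}ᶜ.indicator 1 f := by
    intro f
    simp only [Set.indicator_apply, Pi.one_apply, Finset.sum_boole]
    congr 2
    ext v
    simp
  simp only [hcard]
  rw [integral_finsetSum _ fun v _ => Integrable.of_finite]
  refine Finset.sum_congr rfl fun v _ => ?_
  rw [integral_indicator_one MeasurableSet.of_discrete,
    probReal_compl_eq_one_sub MeasurableSet.of_discrete, measureReal_pi_forall_ne]

theorem measureReal_uniformOn_univ_singleton (v : α) :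
    (uniformOn (Set.univ : Set α)).real {v} = 1 / Fintype.card α := by
  rw [measureReal_def, uniformOn_univ, Measure.count_singleton]
  simp

end IIDSamples

section MeanDistinct

/-- The expected number of distinct members met in `n` uniform draws from a community whose
collision probability, the inverse of its size, is `p`: the `j`-th draw meets a new member with
probability `(1 - p) ^ j`, counting from `j = 0`. -/
noncomputable def meanDistinct (p : ℝ) (n : ℕ) : ℝ :=
  ∑ j ∈ Finset.range n, (1 - p) ^ j

theorem integral_card_image_uniform {ι α : Type*} [Fintype ι] [Fintype α] [Nonempty α]
    [DecidableEq α] [MeasurableSpace α] [MeasurableSingletonClass α] (s : Finset ι) :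
    ∫ f, ((s.image f).card : ℝ) ∂(Measure.pi fun _ : ι => uniformOn (Set.univ : Set α)) =
      meanDistinct (1 / Fintype.card α) s.card := by
  have hcard : (Fintype.card α : ℝ) ≠ 0 := by positivity
  simp only [integral_card_image, measureReal_uniformOn_univ_singleton, Finset.sum_const,
    Finset.card_univ, nsmul_eq_mul, meanDistinct, ← geom_sum_mul_neg]
  field_simp
  ring

variable {p q : ℝ}

theorem meanDistinct_antitone (hpq : p ≤ q) (hq : q ≤ 1) (n : ℕ) :
    meanDistinct q n ≤ meanDistinct p n :=
  Finset.sum_le_sum fun _ _ => pow_le_pow_left₀ (by linarith) (by linarith) _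

theorem meanDistinct_le_natCast (hp : 0 ≤ p) (hp1 : p ≤ 1) (n : ℕ) : meanDistinct p n ≤ n := by
  refine (Finset.sum_le_card_nsmul _ _ 1 fun j _ => ?_).trans_eq (by simp)
  exact pow_le_one₀ (by linarith) (by linarith)

theorem meanDistinct_of_le_one {n : ℕ} (hn : n ≤ 1) : meanDistinct p n = n := by
  interval_cases n <;> simp [meanDistinct]

theorem one_sub_pow_sub_one_sub_pow_le (hp : 0 ≤ p) (hpq : p ≤ q) (hq : q ≤ 1) (j : ℕ) :
    (1 - p) ^ j - (1 - q) ^ j ≤ j * (q - p) := by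
  induction j with
  | zero => simp
  | succ j ih =>
    have hpow : (1 - p) ^ j ≤ 1 := pow_le_one₀ (by linarith) (by linarith)
    calc (1 - p) ^ (j + 1) - (1 - q) ^ (j + 1)
        = (q - p) * (1 - p) ^ j + (1 - q) * ((1 - p) ^ j - (1 - q) ^ j) := by ring
      _ ≤ (q - p) * 1 + (1 - q) * (j * (q - p)) := by gcongr
      _ ≤ (q - p) * 1 + 1 * (j * (q - p)) := by gcongr; linarith
      _ = ((j + 1 : ℕ) : ℝ) * (q - p) := by push_cast; ring

theorem meanDistinct_sub_meanDistinct_le (hp : 0 ≤ p) (hpq : p ≤ q) (hq : q ≤ 1) (n : ℕ) :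
    meanDistinct p n - meanDistinct q n ≤ n.choose 2 * (q - p) := by
  rw [meanDistinct, meanDistinct, ← Finset.sum_sub_distrib, Nat.choose_two_right,
    ← Finset.sum_range_id, Nat.cast_sum, Finset.sum_mul]
  exact Finset.sum_le_sum fun j _ => one_sub_pow_sub_one_sub_pow_le hp hpq hq j

end MeanDistinct

section Greedy

theorem sum_range_le_sum_range_add_mul {a : ℕ → ℝ} {θ : ℝ} {n : ℕ} (hlt : ∀ j < n, θ ≤ a j)
    (hge : ∀ j, n ≤ j → a j ≤ θ) (n' : ℕ) :
    ∑ j ∈ Finset.range n', a j ≤ ∑ j ∈ Finset.range n, a j + ((n' : ℝ) - n) * θ := by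
  rcases le_total n n' with h | h
  · have := Finset.sum_le_card_nsmul (Finset.Ico n n') a θ fun j hj =>
      hge j (Finset.mem_Ico.1 hj).1
    rw [Nat.card_Ico, nsmul_eq_mul, Nat.cast_sub h] at this
    linarith [Finset.sum_range_add_sum_Ico a h]
  · have := Finset.card_nsmul_le_sum (Finset.Ico n' n) a θ fun j hj =>
      hlt j (Finset.mem_Ico.1 hj).2
    rw [Nat.card_Ico, nsmul_eq_mul, Nat.cast_sub h] at this
    linarith [Finset.sum_range_add_sum_Ico a h]

/-- Complementary slackness: `θ` is the price of one unit of budget. -/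
theorem sum_sum_range_le_of_threshold {ι : Type*} [Fintype ι] {a : ι → ℕ → ℝ} {θ : ℝ}
    (hθ : 0 ≤ θ) {n n' : ι → ℕ} (hlt : ∀ i, ∀ j < n i, θ ≤ a i j)
    (hge : ∀ i j, n i ≤ j → a i j ≤ θ) (hn : ∑ i, n' i ≤ ∑ i, n i) :
    ∑ i, ∑ j ∈ Finset.range (n' i), a i j ≤ ∑ i, ∑ j ∈ Finset.range (n i), a i j := by
  have hn' : ∑ i, (n' i : ℝ) ≤ ∑ i, (n i : ℝ) := by exact_mod_cast hn
  have hsum := Finset.sum_le_sum fun i (_ : i ∈ Finset.univ) =>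
    sum_range_le_sum_range_add_mul (hlt i) (hge i) (n' i)
  rw [Finset.sum_add_distrib, ← Finset.sum_mul, Finset.sum_sub_distrib] at hsum
  nlinarith

variable {m s : ℕ} {μ : Fin m → ℝ} {k : Fin m → ℕ}

theorem GreedyAllocation.sum_eq (h : GreedyAllocation μ s k) : ∑ i, k i = s := by
  induction h with
  | zero => simp
  | @step _ k i _ _ ih =>
    rw [Finset.sum_update_of_mem (Finset.mem_univ i), ← ih,
      ← Finset.add_sum_erase _ _ (Finset.mem_univ i), Finset.sdiff_singleton_eq_erase]
    ring

theorem GreedyAllocation.pow_le_pow_of_lt (h : GreedyAllocation μ s k) (h0 : ∀ i, 0 ≤ μ i)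
    (h1 : ∀ i, μ i ≤ 1) {i : Fin m} {n : ℕ} (hn : n < k i) (j : Fin m) :
    (1 - μ j) ^ k j ≤ (1 - μ i) ^ n := by
  have hanti : ∀ i, Antitone fun n : ℕ => (1 - μ i) ^ n := fun i =>
    pow_right_anti₀ (sub_nonneg.2 (h1 i)) (sub_le_self _ (h0 i))
  induction h with
  | zero => exact absurd hn n.not_lt_zero
  | @step _ k a _ ha ih =>
    have hk : k ≤ Function.update k a (k a + 1) := le_update_self_iff.2 (k a).le_succ
    refine (hanti j (hk j)).trans ?_
    rcases eq_or_ne i a with rfl | hia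
    · rw [Function.update_self, Nat.lt_succ_iff] at hn
      exact (ha j).trans (hanti i hn)
    · rw [Function.update_of_ne hia] at hn
      exact ih hn

theorem GreedyAllocation.sum_meanDistinct_le (h : GreedyAllocation μ s k) (h0 : ∀ i, 0 ≤ μ i)
    (h1 : ∀ i, μ i ≤ 1) {k' : Fin m → ℕ} (hk' : ∑ i, k' i ≤ s) :
    ∑ i, meanDistinct (μ i) (k' i) ≤ ∑ i, meanDistinct (μ i) (k i) := by
  have hle : ∀ i, (1 - μ i) ^ k i ≤ ⨆ j, (1 - μ j) ^ k j := fun i =>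
    le_ciSup (f := fun j => (1 - μ j) ^ k j) (Set.finite_range _).bddAbove i
  refine sum_sum_range_le_of_threshold (θ := ⨆ j, (1 - μ j) ^ k j)
    (Real.iSup_nonneg fun i => pow_nonneg (sub_nonneg.2 (h1 i)) _) (fun i n hn => ?_)
    (fun i n hn => ?_) (hk'.trans_eq h.sum_eq.symm)
  · have : Nonempty (Fin m) := ⟨i⟩
    exact ciSup_le (h.pow_le_pow_of_lt h0 h1 hn)
  · exact (pow_le_pow_of_le_one (sub_nonneg.2 (h1 i)) (sub_le_self _ (h0 i)) hn).trans (hle i)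

end Greedy

section ExpectedReward

variable {m K : ℕ} {d : Fin m → ℕ}

theorem length_feedback (k : Fin m → ℕ) (φ : Realization K d) (i : Fin m) :
    (feedback k φ i).length = min (k i) K := by
  simp [feedback]

theorem toFinset_feedback (k : Fin m → ℕ) (φ : Realization K d) (i : Fin m) :
    (feedback k φ i).toFinset = ({j : Fin K | (j : ℕ) < k i} : Finset (Fin K)).image (φ i) := by
  ext v
  simp only [feedback, List.mem_toFinset, List.mem_take_iff_getElem, List.length_ofFn,
    List.getElem_ofFn, Finset.mem_image, Finset.mem_filter, Finset.mem_univ, true_and]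
  constructor
  · rintro ⟨j, hj, rfl⟩
    exact ⟨⟨j, by omega⟩, by simp; omega, rfl⟩
  · rintro ⟨j, hj, rfl⟩
    exact ⟨j, by omega, rfl⟩

variable [∀ i, NeZero (d i)]

instance : IsProbabilityMeasure (realizationLaw K d) := by
  unfold realizationLaw
  infer_instance

theorem measurePreserving_eval_realizationLaw (i : Fin m) :
    MeasurePreserving (Function.eval i) (realizationLaw K d)
      (Measure.pi fun _ : Fin K => uniformOn (Set.univ : Set (Fin (d i)))) :=
  measurePreserving_eval _ i

theorem integral_realizationLaw_eval (i : Fin m) (f : (Fin K → Fin (d i)) → ℝ) :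
    ∫ φ, f (φ i) ∂(realizationLaw K d) =
      ∫ x, f x ∂(Measure.pi fun _ : Fin K => uniformOn (Set.univ : Set (Fin (d i)))) := by
  rw [← (measurePreserving_eval_realizationLaw i).map_eq,
    integral_map (measurable_pi_apply i).aemeasurable Measurable.of_discrete.aestronglyMeasurable]

theorem expectedReward_eq_sum_meanDistinct {k : Fin m → ℕ} (hk : ∀ i, k i ≤ K) :
    expectedReward K d k = ∑ i, meanDistinct (1 / d i) (k i) := by
  simp only [expectedReward, reward, toFinset_feedback, Nat.cast_sum]
  rw [integral_finsetSum _ fun _ _ => Integrable.of_finite]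
  refine Finset.sum_congr rfl fun i _ => ?_
  rw [integral_realizationLaw_eval i fun x => ((Finset.image x _).card : ℝ),
    integral_card_image_uniform, Fintype.card_fin, Fin.card_filter_val_lt, min_eq_right (hk i)]

end ExpectedReward

section Inequalities

theorem add_one_choose_two_add_le (a b : ℕ) :
    (a + 1).choose 2 + (b + 1).choose 2 ≤ (a + b + 1).choose 2 := by
  rw [← Nat.cast_le (α := ℝ)]
  push_cast [Nat.cast_choose_two]
  nlinarith [mul_nonneg (Nat.cast_nonneg (α := ℝ) a) (Nat.cast_nonneg (α := ℝ) b)]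

theorem sum_add_one_choose_two_le {ι : Type*} (s : Finset ι) (n : ι → ℕ) :
    ∑ i ∈ s, (n i + 1).choose 2 ≤ (∑ i ∈ s, n i + 1).choose 2 := by
  classical
  induction s using Finset.induction_on with
  | empty => simp
  | insert a s ha ih =>
    rw [Finset.sum_insert ha, Finset.sum_insert ha]
    exact (Nat.add_le_add_left ih _).trans (add_one_choose_two_add_le _ _)

theorem sum_choose_two_le {ι : Type*} [Fintype ι] {k : ι → ℕ} (hk : ∀ i, 1 ≤ k i) :
    ∑ i, (k i).choose 2 ≤ (∑ i, k i - Fintype.card ι + 1).choose 2 := by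
  obtain ⟨n, rfl⟩ : ∃ n : ι → ℕ, k = fun i => n i + 1 :=
    ⟨fun i => k i - 1, funext fun i => (Nat.sub_add_cancel (hk i)).symm⟩
  simpa [Finset.sum_add_distrib] using sum_add_one_choose_two_le Finset.univ n

theorem max_div_sqrt_sub_one_le {c : ℝ} (hc : 0 ≤ c) (s : ℕ) :
    max 0 (c / √((s + 1 : ℕ) : ℝ) - 1) ≤
      max 0 (c - √(s : ℝ)) ^ 2 - max 0 (c - √((s + 1 : ℕ) : ℝ)) ^ 2 := by
  set x := √(s : ℝ)
  set y := √((s + 1 : ℕ) : ℝ)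
  have hx : 0 ≤ x := Real.sqrt_nonneg _
  have hy : 0 < y := Real.sqrt_pos.2 (by positivity)
  have hxy : x ≤ y := Real.sqrt_le_sqrt (by simp)
  have hsq : y ^ 2 - x ^ 2 = 1 := by
    simp only [x, y, Real.sq_sqrt (Nat.cast_nonneg _)]
    push_cast
    ring
  rcases le_total y c with hyc | hcy
  · rw [max_eq_right (sub_nonneg.2 ((one_le_div hy).2 hyc)),
      max_eq_right (sub_nonneg.2 (hxy.trans hyc)), max_eq_right (sub_nonneg.2 hyc)]
    have hinv : 1 / y ≤ 2 * (y - x) := by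
      rw [div_le_iff₀ hy]
      nlinarith
    have hdiv : c / y ≤ c * (2 * (y - x)) := by
      rw [div_eq_mul_one_div]
      gcongr
    linarith
  · rw [max_eq_left (sub_nonpos.2 ((div_le_one hy).2 hcy)), max_eq_left (sub_nonpos.2 hcy)]
    nlinarith [sq_nonneg (max 0 (c - x))]

theorem sum_max_div_sqrt_sub_le {a M : ℝ} (ha : 0 ≤ a) (hM : 0 < M) (N : ℕ) :
    ∑ s ∈ Finset.range N, max 0 (a / √((s + 1 : ℕ) : ℝ) - M) ≤ a ^ 2 / M := by
  have hscale : ∀ s : ℕ, max 0 (a / √((s + 1 : ℕ) : ℝ) - M) =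
      M * max 0 (a / M / √((s + 1 : ℕ) : ℝ) - 1) := by
    intro s
    rw [mul_max_of_nonneg _ _ hM.le, mul_zero]
    congr 1
    field_simp
  simp only [hscale, ← Finset.mul_sum]
  calc M * ∑ s ∈ Finset.range N, max 0 (a / M / √((s + 1 : ℕ) : ℝ) - 1)
      ≤ M * ∑ s ∈ Finset.range N, (max 0 (a / M - √(s : ℝ)) ^ 2 -
          max 0 (a / M - √((s + 1 : ℕ) : ℝ)) ^ 2) := by
        gcongr
        exact max_div_sqrt_sub_one_le (by positivity) _
    _ ≤ M * (a / M) ^ 2 := by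
        rw [Finset.sum_range_sub' fun s : ℕ => max 0 (a / M - √(s : ℝ)) ^ 2]
        gcongr
        simp only [Nat.cast_zero, Real.sqrt_zero, sub_zero, max_eq_right (div_nonneg ha hM.le)]
        exact sub_le_self _ (sq_nonneg _)
    _ = a ^ 2 / M := by field_simp

theorem sum_one_div_sq_le (T : ℕ) :
    ∑ t ∈ Finset.range T, 1 / ((t + 1 : ℕ) : ℝ) ^ 2 ≤ Real.pi ^ 2 / 6 := by
  have h := hasSum_zeta_two.summable.sum_le_tsum (Finset.range (T + 1)) fun i _ => by positivity
  rw [hasSum_zeta_two.tsum_eq, Finset.sum_range_succ'] at h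
  simpa using h

theorem le_sum_max_two_mul_sub {ι : Type*} {s : Finset ι} {c w : ι → ℝ} {B g : ℝ}
    (hc : ∀ i ∈ s, 0 ≤ c i) (hcB : ∑ i ∈ s, c i ≤ B) (hg : 0 ≤ g)
    (hgw : g ≤ ∑ i ∈ s, c i * w i) :
    g ≤ ∑ i ∈ s, max 0 (2 * B * w i - g) := by
  have hB : 0 ≤ B := (Finset.sum_nonneg hc).trans hcB
  have hcle : ∀ i ∈ s, c i ≤ B := fun i hi => (Finset.single_le_sum hc hi).trans hcB
  rcases hB.eq_or_lt with rfl | hBpos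
  · have hzero : ∀ i ∈ s, c i * w i = 0 := fun i hi => by
      rw [le_antisymm (hcle i hi) (hc i hi), zero_mul]
    exact (hgw.trans_eq (Finset.sum_eq_zero hzero)).trans
      (Finset.sum_nonneg fun _ _ => le_max_left _ _)
  refine le_of_mul_le_mul_left ?_ hBpos
  calc B * g ≤ 2 * B * ∑ i ∈ s, c i * w i - (∑ i ∈ s, c i) * g := by nlinarith
    _ = ∑ i ∈ s, c i * (2 * B * w i - g) := by
        rw [Finset.mul_sum, Finset.sum_mul, ← Finset.sum_sub_distrib]
        exact Finset.sum_congr rfl fun _ _ => by ring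
    _ ≤ ∑ i ∈ s, B * max 0 (2 * B * w i - g) := Finset.sum_le_sum fun i hi =>
        (mul_le_mul_of_nonneg_left (le_max_right _ _) (hc i hi)).trans
          (mul_le_mul_of_nonneg_right (hcle i hi) (le_max_left _ _))
    _ = B * ∑ i ∈ s, max 0 (2 * B * w i - g) := (Finset.mul_sum _ _ _).symm

end Inequalities

section CollisionAverage

theorem lintegral_exp_centered_le_one {Ω : Type*} {mΩ : MeasurableSpace Ω} {P : Measure Ω}
    [IsProbabilityMeasure P] {X : Ω → ℝ} (hX : AEMeasurable X P)
    (hX01 : ∀ᵐ ω ∂P, X ω ∈ Set.Icc 0 1) (l : ℝ) :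
    ∫⁻ ω, ENNReal.ofReal (Real.exp (l * (X ω - ∫ ω', X ω' ∂P) - l ^ 2 / 8)) ∂P ≤ 1 := by
  have hsub := hasSubgaussianMGF_of_mem_Icc hX hX01
  have hmgf := hsub.mgf_le l
  rw [mgf] at hmgf
  simp only [Real.exp_sub]
  rw [← ofReal_integral_eq_lintegral_ofReal ((hsub.integrable_exp_mul l).div_const _)
    (ae_of_all _ fun _ => by positivity), ← ENNReal.ofReal_one, integral_div]
  refine ENNReal.ofReal_le_ofReal ((div_le_one (Real.exp_pos _)).2 (hmgf.trans_eq ?_))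
  norm_num
  ring

theorem collisionAverage_mem_Icc {α : Type*} [DecidableEq α] (S : List α) :
    collisionAverage S ∈ Set.Icc (0 : ℝ) 1 := by
  rw [collisionAverage, Finset.sum_boole]
  refine ⟨by positivity, div_le_one_of_le₀ ?_ (Nat.cast_nonneg _)⟩
  exact_mod_cast (Finset.card_filter_le _ _).trans_eq (Finset.card_range _)

theorem integral_collisionAverage {K n : ℕ} {α : Type*} [Fintype α] [DecidableEq α]
    [MeasurableSpace α] [MeasurableSingletonClass α] {ν : Measure α} [IsProbabilityMeasure ν]
    (hn : 1 < min n K) :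
    ∫ f, collisionAverage ((List.ofFn f).take n) ∂(Measure.pi fun _ : Fin K => ν) =
      ∑ v, ν.real {v} ^ 2 := by
  have hpair : ∀ x ∈ Finset.range (min n K / 2), ∫ f : Fin K → α,
      (if ((List.ofFn f).take n)[2 * x]? = ((List.ofFn f).take n)[2 * x + 1]? then (1 : ℝ) else 0)
        ∂(Measure.pi fun _ => ν) = ∑ v, ν.real {v} ^ 2 := by
    intro x hx
    rw [Finset.mem_range] at hx
    have ha : 2 * x < K := by omega
    have hb : 2 * x + 1 < K := by omega
    rw [← measureReal_pi_collision (a := (⟨2 * x, ha⟩ : Fin K)) (b := ⟨2 * x + 1, hb⟩) (by simp),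
      ← integral_indicator_one MeasurableSet.of_discrete]
    congr 1 with f
    rw [List.getElem?_take_of_lt (by omega), List.getElem?_take_of_lt (by omega)]
    simp [Set.indicator_apply, ha, hb]
  have hhalf : ((min n K / 2 : ℕ) : ℝ) ≠ 0 := Nat.cast_ne_zero.2 (by omega)
  simp only [collisionAverage, List.length_take, List.length_ofFn]
  rw [integral_div, integral_finsetSum _ fun _ _ => Integrable.of_finite,
    Finset.sum_congr rfl hpair, Finset.sum_const, Finset.card_range, nsmul_eq_mul,
    mul_div_cancel_left₀ _ hhalf]

variable {m K : ℕ} {d : Fin m → ℕ} [∀ i, NeZero (d i)]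

theorem integral_collisionAverage_feedback {k : Fin m → ℕ} {i : Fin m} (hk : 1 < min (k i) K) :
    ∫ φ, collisionAverage (feedback k φ i) ∂(realizationLaw K d) = 1 / d i := by
  have hd : (d i : ℝ) ≠ 0 := NeZero.ne _
  simp only [feedback]
  rw [integral_realizationLaw_eval i fun x => collisionAverage ((List.ofFn x).take (k i)),
    integral_collisionAverage hk]
  simp only [measureReal_uniformOn_univ_singleton, Fintype.card_fin, Finset.sum_const,
    Finset.card_univ, nsmul_eq_mul]
  field_simp

end CollisionAverage

section Memory

variable {m K : ℕ} {d : Fin m → ℕ}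

section Pathwise

variable (k : ℕ → Fin m → ℕ) (φ : ℕ → Realization K d) (i : Fin m)

theorem count_stateAfter_succ (t : ℕ) :
    (stateAfter k φ (t + 1)).count i = (stateAfter k φ t).count i +
      if 1 < (feedback (k (t + 1)) (φ (t + 1)) i).length then 1 else 0 :=
  rfl

theorem mean_stateAfter_succ (t : ℕ) :
    (stateAfter k φ (t + 1)).mean i =
      if 1 < (feedback (k (t + 1)) (φ (t + 1)) i).length then
        (stateAfter k φ t).mean i + (collisionAverage (feedback (k (t + 1)) (φ (t + 1)) i) -
          (stateAfter k φ t).mean i) / (((stateAfter k φ t).count i + 1 : ℕ) : ℝ)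
      else (stateAfter k φ t).mean i :=
  rfl

theorem count_stateAfter_le (t : ℕ) : (stateAfter k φ t).count i ≤ t := by
  induction t with
  | zero => exact le_rfl
  | succ t ih =>
    rw [count_stateAfter_succ]
    split_ifs <;> omega

theorem mean_stateAfter_of_count_eq_zero {t : ℕ} (h : (stateAfter k φ t).count i = 0) :
    (stateAfter k φ t).mean i = 0 := by
  induction t with
  | zero => rfl
  | succ t ih =>
    rw [count_stateAfter_succ] at h
    rw [mean_stateAfter_succ]
    split_ifs at h ⊢ with hlen
    exact ih h

theorem sum_ite_comp_count_stateAfter {M : Type*} [AddCommMonoid M] (f : ℕ → M) (T : ℕ) :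
    (∑ t ∈ Finset.range T, if 1 < (feedback (k (t + 1)) (φ (t + 1)) i).length then
      f ((stateAfter k φ t).count i) else 0) =
      ∑ n ∈ Finset.range ((stateAfter k φ T).count i), f n := by
  induction T with
  | zero => rfl
  | succ T ih =>
    rw [Finset.sum_range_succ, ih, count_stateAfter_succ]
    split_ifs
    · rw [Finset.sum_range_succ]
    · rw [add_zero, add_zero]

end Pathwise

variable {Ω : Type*} {mΩ : MeasurableSpace Ω} {P : Measure Ω} {ℱ : Filtration ℕ mΩ}
  {Φ : ℕ → Ω → Realization K d} {k : ℕ → Ω → Fin m → ℕ}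

/-- The memory of the learner at the end of round `t`, as a random variable. -/
noncomputable abbrev stateProcess (k : ℕ → Ω → Fin m → ℕ) (Φ : ℕ → Ω → Realization K d) (t : ℕ)
    (ω : Ω) : LearnerState m :=
  stateAfter (fun s => k s ω) (fun s => Φ s ω) t

theorem measurable_comp_round (henv : IsOnlineEnvironment d P ℱ Φ)
    (hk : ∀ t, Measurable[ℱ t] (k (t + 1))) {β : Type*} [MeasurableSpace β]
    (f : (Fin m → ℕ) → Realization K d → β) (t : ℕ) :
    Measurable[ℱ (t + 1)] fun ω => f (k (t + 1) ω) (Φ (t + 1) ω) :=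
  (Measurable.of_discrete (f := fun p : (Fin m → ℕ) × Realization K d => f p.1 p.2)).comp
    (((hk t).mono (ℱ.mono t.le_succ) le_rfl).prodMk (henv.adapted t))

theorem measurable_count_stateProcess (henv : IsOnlineEnvironment d P ℱ Φ)
    (hk : ∀ t, Measurable[ℱ t] (k (t + 1))) (i : Fin m) (t : ℕ) :
    Measurable[ℱ t] fun ω => (stateProcess k Φ t ω).count i := by
  induction t with
  | zero => exact measurable_const
  | succ t ih =>
    exact (ih.mono (ℱ.mono t.le_succ) le_rfl).add
      (measurable_comp_round henv hk (fun a φ => if 1 < (feedback a φ i).length then 1 else 0) t)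

theorem measurable_mean_stateProcess (henv : IsOnlineEnvironment d P ℱ Φ)
    (hk : ∀ t, Measurable[ℱ t] (k (t + 1))) (i : Fin m) (t : ℕ) :
    Measurable[ℱ t] fun ω => (stateProcess k Φ t ω).mean i := by
  induction t with
  | zero => exact measurable_const
  | succ t ih =>
    have hmean := ih.mono (ℱ.mono t.le_succ) le_rfl
    have hcount : Measurable[ℱ (t + 1)] fun ω =>
        (((stateProcess k Φ t ω).count i + 1 : ℕ) : ℝ) :=
      (Measurable.of_discrete (f := fun n : ℕ => ((n + 1 : ℕ) : ℝ))).comp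
        ((measurable_count_stateProcess henv hk i t).mono (ℱ.mono t.le_succ) le_rfl)
    have hlen : MeasurableSet[ℱ (t + 1)]
        {ω | 1 < (feedback (k (t + 1) ω) (Φ (t + 1) ω) i).length} :=
      measurableSet_lt measurable_const
        (measurable_comp_round henv hk (fun a φ => (feedback a φ i).length) t)
    exact Measurable.ite hlen (hmean.add (((measurable_comp_round henv hk
      (fun a φ => collisionAverage (feedback a φ i)) t).sub hmean).div hcount)) hmean

theorem map_prodMk_realization [IsFiniteMeasure P]
    (henv : IsOnlineEnvironment d P ℱ Φ) {A : Type*} [MeasurableSpace A] {Y : Ω → A} {t : ℕ}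
    (hY : Measurable[ℱ t] Y) :
    P.map (fun ω => (Y ω, Φ (t + 1) ω)) = (P.map Y).prod (realizationLaw K d) := by
  have hindep : IndepFun Y (Φ (t + 1)) P := indep_of_indep_of_le_left (henv.indep t) hY.comap_le
  rw [← henv.law t]
  exact (indepFun_iff_map_prod_eq_prod_map_map (hY.mono (ℱ.le t) le_rfl).aemeasurable
    ((henv.adapted t).mono (ℱ.le (t + 1)) le_rfl).aemeasurable).1 hindep

theorem lintegral_comp_realization [IsFiniteMeasure P]
    (henv : IsOnlineEnvironment d P ℱ Φ) {A : Type*} [MeasurableSpace A] {Y : Ω → A} {t : ℕ}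
    (hY : Measurable[ℱ t] Y) {g : A → Realization K d → ENNReal}
    (hg : Measurable (Function.uncurry g)) :
    ∫⁻ ω, g (Y ω) (Φ (t + 1) ω) ∂P = ∫⁻ ω, ∫⁻ φ, g (Y ω) φ ∂(realizationLaw K d) ∂P := by
  have hY' := hY.mono (ℱ.le t) le_rfl
  have hΦ := (henv.adapted t).mono (ℱ.le (t + 1)) le_rfl
  calc ∫⁻ ω, g (Y ω) (Φ (t + 1) ω) ∂P
      = ∫⁻ p, Function.uncurry g p ∂(P.map fun ω => (Y ω, Φ (t + 1) ω)) :=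
        (lintegral_map hg (hY'.prodMk hΦ)).symm
    _ = ∫⁻ a, ∫⁻ φ, g a φ ∂(realizationLaw K d) ∂(P.map Y) := by
        rw [map_prodMk_realization henv hY, lintegral_prod _ hg.aemeasurable]
        rfl
    _ = ∫⁻ ω, ∫⁻ φ, g (Y ω) φ ∂(realizationLaw K d) ∂P :=
        lintegral_map hg.lintegral_prod_right' hY'

theorem integral_comp_realization [IsFiniteMeasure P]
    (henv : IsOnlineEnvironment d P ℱ Φ) {A : Type*} [MeasurableSpace A] {Y : Ω → A} {t : ℕ}
    (hY : Measurable[ℱ t] Y) {g : A → Realization K d → ℝ}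
    (hg : StronglyMeasurable (Function.uncurry g))
    (hint : Integrable (fun ω => g (Y ω) (Φ (t + 1) ω)) P) :
    ∫ ω, g (Y ω) (Φ (t + 1) ω) ∂P = ∫ ω, ∫ φ, g (Y ω) φ ∂(realizationLaw K d) ∂P := by
  have hY' := hY.mono (ℱ.le t) le_rfl
  have hΦ := (henv.adapted t).mono (ℱ.le (t + 1)) le_rfl
  have hYΦ := (hY'.prodMk hΦ).aemeasurable (μ := P)
  have hint' : Integrable (Function.uncurry g) ((P.map Y).prod (realizationLaw K d)) := by
    rw [← map_prodMk_realization henv hY]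
    exact (integrable_map_measure hg.aestronglyMeasurable hYΦ).2 hint
  calc ∫ ω, g (Y ω) (Φ (t + 1) ω) ∂P
      = ∫ p, Function.uncurry g p ∂(P.map fun ω => (Y ω, Φ (t + 1) ω)) :=
        (integral_map hYΦ hg.aestronglyMeasurable).symm
    _ = ∫ a, ∫ φ, g a φ ∂(realizationLaw K d) ∂(P.map Y) := by
        rw [map_prodMk_realization henv hY, integral_prod _ hint']
        rfl
    _ = ∫ ω, ∫ φ, g (Y ω) φ ∂(realizationLaw K d) ∂P :=
        integral_map hY'.aemeasurable hg.integral_prod_right'.aestronglyMeasurable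

end Memory

section Concentration

variable {m K : ℕ} {d : Fin m → ℕ}

/-- Hoeffding's exponential supermartingale: the exponential of `l` times the sum of the centred
observations made in community `i`, with the compensation `l ^ 2 / 8` per observation. -/
noncomputable def expDeviation (d : Fin m → ℕ) (l : ℝ) (i : Fin m) (σ : LearnerState m) :
    ENNReal :=
  ENNReal.ofReal
    (Real.exp (l * (σ.count i * (σ.mean i - 1 / d i)) - l ^ 2 / 8 * σ.count i))

theorem expDeviation_update (l : ℝ) (i : Fin m) (σ : LearnerState m)
    (S : (i : Fin m) → List (Fin (d i))) :
    expDeviation d l i (σ.update S) = expDeviation d l i σ *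
      if 1 < (S i).length then
        ENNReal.ofReal (Real.exp (l * (collisionAverage (S i) - 1 / d i) - l ^ 2 / 8))
      else 1 := by
  simp only [expDeviation, LearnerState.update]
  split_ifs
  · have hcount : (σ.count i : ℝ) + 1 ≠ 0 := by positivity
    rw [← ENNReal.ofReal_mul (Real.exp_pos _).le, ← Real.exp_add]
    push_cast
    congr 2
    field_simp
    ring
  · rw [mul_one, add_zero]

theorem lintegral_exp_collisionAverage_feedback_le [∀ i, NeZero (d i)] {k : Fin m → ℕ}
    {i : Fin m} (hk : 1 < min (k i) K) (l : ℝ) :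
    ∫⁻ φ, ENNReal.ofReal
      (Real.exp (l * (collisionAverage (feedback k φ i) - 1 / d i) - l ^ 2 / 8))
        ∂(realizationLaw K d) ≤ 1 := by
  rw [← integral_collisionAverage_feedback hk]
  exact lintegral_exp_centered_le_one Measurable.of_discrete.aemeasurable
    (ae_of_all _ fun φ => collisionAverage_mem_Icc _) l

variable {Ω : Type*} {mΩ : MeasurableSpace Ω} {P : Measure Ω} {ℱ : Filtration ℕ mΩ}
  {Φ : ℕ → Ω → Realization K d} {k : ℕ → Ω → Fin m → ℕ}

theorem measurable_expDeviation_stateProcess (henv : IsOnlineEnvironment d P ℱ Φ)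
    (hk : ∀ t, Measurable[ℱ t] (k (t + 1))) (l : ℝ) (i : Fin m) (t : ℕ) :
    Measurable[ℱ t] fun ω => expDeviation d l i (stateProcess k Φ t ω) := by
  have hcount : Measurable[ℱ t] fun ω => ((stateProcess k Φ t ω).count i : ℝ) :=
    measurable_from_top.comp (measurable_count_stateProcess henv hk i t)
  have hmean := measurable_mean_stateProcess henv hk i t
  exact ENNReal.measurable_ofReal.comp (Real.measurable_exp.comp
    (((hcount.mul (hmean.sub_const _)).const_mul l).sub (hcount.const_mul _)))

/-- With the memory `σ`, the confidence intervals of round `t` are valid: wherever there are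
observations, the empirical mean is within the confidence radius of the true mean. -/
def IsAccurate (d : Fin m → ℕ) (σ : LearnerState m) (t : ℕ) : Prop :=
  ∀ i, 0 < σ.count i → |σ.mean i - 1 / d i| ≤ σ.radius t i

theorem measurableSet_isAccurate (henv : IsOnlineEnvironment d P ℱ Φ)
    (hk : ∀ t, Measurable[ℱ t] (k (t + 1))) (t n : ℕ) :
    MeasurableSet {ω | IsAccurate d (stateProcess k Φ t ω) n} := by
  simp only [IsAccurate, Set.ofPred_forall]
  refine MeasurableSet.iInter fun i => ?_
  have hcount := (measurable_count_stateProcess henv hk i t).mono (ℱ.le t) le_rfl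
  have hmean := (measurable_mean_stateProcess henv hk i t).mono (ℱ.le t) le_rfl
  have hradius : Measurable fun ω => (stateProcess k Φ t ω).radius n i :=
    (Measurable.of_discrete (f := fun c : ℕ =>
      if c = 0 then 0 else √(3 * Real.log n / (2 * c)))).comp hcount
  exact (measurableSet_lt measurable_const hcount).imp
    (measurableSet_le (continuous_abs.measurable.comp (hmean.sub_const _)) hradius)

variable [∀ i, NeZero (d i)] [IsProbabilityMeasure P]

theorem lintegral_expDeviation_stateProcess_le_one (henv : IsOnlineEnvironment d P ℱ Φ)
    (hk : ∀ t, Measurable[ℱ t] (k (t + 1))) (l : ℝ) (i : Fin m) (t : ℕ) :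
    ∫⁻ ω, expDeviation d l i (stateProcess k Φ t ω) ∂P ≤ 1 := by
  induction t with
  | zero => simp [stateProcess, stateAfter, expDeviation, LearnerState.init]
  | succ t ih =>
    let factor : (Fin m → ℕ) → Realization K d → ENNReal := fun a φ =>
      if 1 < (feedback a φ i).length then
        ENNReal.ofReal (Real.exp (l * (collisionAverage (feedback a φ i) - 1 / d i) - l ^ 2 / 8))
      else 1
    have hfactor : ∀ a, ∫⁻ φ, factor a φ ∂(realizationLaw K d) ≤ 1 := by
      intro a
      simp only [factor, length_feedback]
      split_ifs with ha
      · exact lintegral_exp_collisionAverage_feedback_le ha l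
      · simp
    have hmeas : Measurable (Function.uncurry fun (y : ENNReal × (Fin m → ℕ)) φ =>
        y.1 * factor y.2 φ) :=
      measurable_fst.fst.mul ((Measurable.of_discrete
        (f := fun p : (Fin m → ℕ) × Realization K d => factor p.1 p.2)).comp
        (measurable_fst.snd.prodMk measurable_snd))
    calc ∫⁻ ω, expDeviation d l i (stateProcess k Φ (t + 1) ω) ∂P
        = ∫⁻ ω, expDeviation d l i (stateProcess k Φ t ω) *
            factor (k (t + 1) ω) (Φ (t + 1) ω) ∂P :=
          lintegral_congr fun ω => expDeviation_update _ _ _ _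
      _ = ∫⁻ ω, ∫⁻ φ, expDeviation d l i (stateProcess k Φ t ω) * factor (k (t + 1) ω) φ
            ∂(realizationLaw K d) ∂P :=
          lintegral_comp_realization henv
            ((measurable_expDeviation_stateProcess henv hk l i t).prodMk (hk t)) hmeas
      _ ≤ ∫⁻ ω, expDeviation d l i (stateProcess k Φ t ω) ∂P := by
          refine lintegral_mono fun ω => ?_
          rw [lintegral_const_mul _ Measurable.of_discrete]
          exact mul_le_of_le_one_right' (hfactor _)
      _ ≤ 1 := ih

theorem measureReal_count_eq_and_le_mul (henv : IsOnlineEnvironment d P ℱ Φ)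
    (hk : ∀ t, Measurable[ℱ t] (k (t + 1))) (i : Fin m) (t s : ℕ) (l : ℝ) :
    P.real {ω | (stateProcess k Φ t ω).count i = s ∧
      l ^ 2 / 4 ≤ l * ((stateProcess k Φ t ω).mean i - 1 / d i)} ≤ Real.exp (-(s * l ^ 2 / 8)) := by
  refine ENNReal.toReal_le_of_le_ofReal (Real.exp_pos _).le ?_
  have hmarkov := meas_ge_le_lintegral_div (μ := P)
    ((measurable_expDeviation_stateProcess henv hk l i t).mono (ℱ.le t) le_rfl).aemeasurable
    (ENNReal.ofReal_pos.2 (Real.exp_pos (s * l ^ 2 / 8))).ne' ENNReal.ofReal_ne_top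
  calc _ ≤ P {ω | ENNReal.ofReal (Real.exp (s * l ^ 2 / 8)) ≤
          expDeviation d l i (stateProcess k Φ t ω)} := by
        refine measure_mono ?_
        rintro ω ⟨hcount, hmean⟩
        refine ENNReal.ofReal_le_ofReal (Real.exp_le_exp.2 ?_)
        rw [hcount]
        nlinarith [mul_le_mul_of_nonneg_left hmean (Nat.cast_nonneg (α := ℝ) s)]
    _ ≤ 1 / ENNReal.ofReal (Real.exp (s * l ^ 2 / 8)) :=
        hmarkov.trans (ENNReal.div_le_div_right
          (lintegral_expDeviation_stateProcess_le_one henv hk l i t) _)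
    _ = ENNReal.ofReal (Real.exp (-(s * l ^ 2 / 8))) := by
        rw [Real.exp_neg, ENNReal.ofReal_inv_of_pos (Real.exp_pos _), one_div]

theorem measureReal_count_eq_and_le_abs (henv : IsOnlineEnvironment d P ℱ Φ)
    (hk : ∀ t, Measurable[ℱ t] (k (t + 1))) (i : Fin m) (t s : ℕ) {ε : ℝ} (hε : 0 ≤ ε) :
    P.real {ω | (stateProcess k Φ t ω).count i = s ∧
      ε ≤ |(stateProcess k Φ t ω).mean i - 1 / d i|} ≤ 2 * Real.exp (-(2 * s * ε ^ 2)) := by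
  have hupper := measureReal_count_eq_and_le_mul henv hk i t s (4 * ε)
  have hlower := measureReal_count_eq_and_le_mul henv hk i t s (-(4 * ε))
  calc _ ≤ _ := measureReal_mono ?_
    _ ≤ _ := measureReal_union_le _ _
    _ ≤ _ := add_le_add hupper hlower
    _ = 2 * Real.exp (-(2 * s * ε ^ 2)) := by ring_nf
  rintro ω ⟨hcount, hdev⟩
  rcases le_abs'.1 hdev with h | h
  · exact Or.inr ⟨hcount, by nlinarith⟩
  · exact Or.inl ⟨hcount, by nlinarith⟩

theorem measureReal_count_eq_and_radius_le (henv : IsOnlineEnvironment d P ℱ Φ)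
    (hk : ∀ t, Measurable[ℱ t] (k (t + 1))) (i : Fin m) (t : ℕ) {s n : ℕ} (hs : 0 < s)
    (hn : 0 < n) :
    P.real {ω | (stateProcess k Φ t ω).count i = s ∧
      (stateProcess k Φ t ω).radius n i ≤ |(stateProcess k Φ t ω).mean i - 1 / d i|} ≤
      2 * (1 / (n : ℝ) ^ 3) := by
  have hexponent : 2 * s * √(3 * Real.log n / (2 * s)) ^ 2 = Real.log ((n : ℝ) ^ 3) := by
    rw [Real.sq_sqrt (by positivity), Real.log_pow]
    field_simp
    norm_num
    ring
  have hhoeffding := measureReal_count_eq_and_le_abs henv hk i t s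
    (Real.sqrt_nonneg (3 * Real.log n / (2 * s)))
  rw [hexponent, Real.exp_neg, Real.exp_log (by positivity), ← one_div] at hhoeffding
  refine (measureReal_mono ?_).trans hhoeffding
  rintro ω ⟨hcount, hdev⟩
  rw [LearnerState.radius, if_neg (by omega), hcount] at hdev
  exact ⟨hcount, hdev⟩

theorem measureReal_not_isAccurate_le (henv : IsOnlineEnvironment d P ℱ Φ)
    (hk : ∀ t, Measurable[ℱ t] (k (t + 1))) (t : ℕ) :
    P.real {ω | ¬ IsAccurate d (stateProcess k Φ t ω) (t + 1)} ≤
      2 * m * (1 / ((t + 1 : ℕ) : ℝ) ^ 2) := by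
  let failure : Fin m → ℕ → Set Ω := fun i s =>
    {ω | (stateProcess k Φ t ω).count i = s ∧ (stateProcess k Φ t ω).radius (t + 1) i ≤
      |(stateProcess k Φ t ω).mean i - 1 / d i|}
  have hsubset : {ω | ¬ IsAccurate d (stateProcess k Φ t ω) (t + 1)} ⊆
      ⋃ i ∈ (Finset.univ : Finset (Fin m)), ⋃ s ∈ Finset.Icc 1 t, failure i s := by
    intro ω hω
    simp only [Set.mem_ofPred_eq, IsAccurate, not_forall, not_le] at hω
    obtain ⟨i, hcount, hdev⟩ := hω
    simp only [Set.mem_iUnion]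
    exact ⟨i, Finset.mem_univ i, (stateProcess k Φ t ω).count i,
      Finset.mem_Icc.2 ⟨hcount, count_stateAfter_le _ _ i t⟩, rfl, hdev.le⟩
  calc P.real {ω | ¬ IsAccurate d (stateProcess k Φ t ω) (t + 1)}
      ≤ ∑ i : Fin m, ∑ s ∈ Finset.Icc 1 t, P.real (failure i s) :=
        (measureReal_mono hsubset (measure_ne_top _ _)).trans
          ((measureReal_biUnion_finset_le _ _).trans
            (Finset.sum_le_sum fun i _ => measureReal_biUnion_finset_le _ _))
    _ ≤ ∑ _i : Fin m, ∑ _s ∈ Finset.Icc 1 t, 2 * (1 / ((t + 1 : ℕ) : ℝ) ^ 3) :=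
        Finset.sum_le_sum fun i _ => Finset.sum_le_sum fun s hs =>
          measureReal_count_eq_and_radius_le henv hk i t (Finset.mem_Icc.1 hs).1 t.succ_pos
    _ = 2 * m * (t / ((t + 1 : ℕ) : ℝ) ^ 3) := by
        simp only [Finset.sum_const, Nat.card_Icc, Finset.card_univ, Fintype.card_fin,
          nsmul_eq_mul, add_tsub_cancel_right]
        ring
    _ ≤ 2 * m * (1 / ((t + 1 : ℕ) : ℝ) ^ 2) := by
        refine mul_le_mul_of_nonneg_left ?_ (by positivity)
        rw [div_le_div_iff₀ (by positivity) (by positivity)]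
        push_cast
        nlinarith [Nat.cast_nonneg (α := ℝ) t]

end Concentration

section Gaps

theorem one_div_natCast_le_one (n : ℕ) : 1 / (n : ℝ) ≤ 1 :=
  (one_div _).trans_le (Nat.cast_inv_le_one n)

theorem le_of_sum_le {ι : Type*} [Fintype ι] {k : ι → ℕ} {K : ℕ} (hk : ∑ i, k i ≤ K) (i : ι) :
    k i ≤ K :=
  (Finset.single_le_sum (fun _ _ => Nat.zero_le _) (Finset.mem_univ i)).trans hk

variable {m K : ℕ} {d kstar : Fin m → ℕ} {i : Fin m}

theorem finite_badActions : (badActions K d kstar i).Finite :=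
  (Set.finite_Iic fun _ => K).subset fun _ hk j => le_of_sum_le hk.1.le j

theorem gapMin_pos : 0 < gapMin K d kstar i := by
  rcases (badActions K d kstar i).eq_empty_or_nonempty with hempty | hne
  · simp [gapMin, hempty]
  · obtain ⟨k, hk, hmin⟩ := Set.exists_min_image _ (gap K d kstar) finite_badActions hne
    exact (EReal.coe_pos.2 hk.2.1).trans_le
      (le_iInf₂ fun a ha => EReal.coe_le_coe_iff.2 (hmin a ha))

theorem gapMin_le_gap {k : Fin m → ℕ} (hk : k ∈ badActions K d kstar i) :
    gapMin K d kstar i ≤ gap K d kstar k :=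
  iInf₂_le k hk

theorem gapMax_nonneg : 0 ≤ gapMax K d kstar := by
  refine Real.iSup_nonneg fun i => Real.sSup_nonneg ?_
  rintro _ ⟨k, hk, rfl⟩
  exact hk.2.1.le

theorem gap_le_gapMax {k : Fin m → ℕ} (hk : k ∈ badActions K d kstar i) :
    gap K d kstar k ≤ gapMax K d kstar :=
  (le_csSup (finite_badActions.image _).bddAbove (Set.mem_image_of_mem _ hk)).trans
    (le_ciSup (f := gapMaxAt K d kstar) (Set.finite_range _).bddAbove i)

variable [∀ i, NeZero (d i)]

theorem expectedReward_le_of_forall_le_one {k : Fin m → ℕ} (hk : ∀ i, k i ≤ 1)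
    (hkK : ∑ i, k i = K) (hstar : ∑ i, kstar i ≤ K) :
    expectedReward K d kstar ≤ expectedReward K d k := by
  rw [expectedReward_eq_sum_meanDistinct (le_of_sum_le hstar),
    expectedReward_eq_sum_meanDistinct (le_of_sum_le hkK.le)]
  calc ∑ i, meanDistinct (1 / d i) (kstar i)
      ≤ ∑ i, (kstar i : ℝ) := Finset.sum_le_sum fun i _ =>
        meanDistinct_le_natCast (by positivity) (one_div_natCast_le_one _) _
    _ ≤ ∑ i, (k i : ℝ) := by exact_mod_cast hstar.trans_eq hkK.symm
    _ = ∑ i, meanDistinct (1 / d i) (k i) :=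
        Finset.sum_congr rfl fun i _ => (meanDistinct_of_le_one (hk i)).symm

theorem exists_mem_badActions {k : Fin m → ℕ} (hkK : ∑ i, k i = K) (hstar : ∑ i, kstar i ≤ K)
    (hgap : 0 < gap K d kstar k) : ∃ i, k ∈ badActions K d kstar i := by
  by_contra! h
  refine (sub_pos.1 hgap).not_ge (expectedReward_le_of_forall_le_one (fun i => ?_) hkK hstar)
  by_contra! hi
  exact h i ⟨hkK, hgap, hi⟩

theorem gap_le_sum_choose_two {μ : Fin m → ℝ} {k : Fin m → ℕ} (hμ0 : ∀ i, 0 ≤ μ i)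
    (hμ : ∀ i, μ i ≤ 1 / d i) (hk : GreedyAllocation μ K k) (hstar : ∑ i, kstar i ≤ K) :
    gap K d kstar k ≤ ∑ i, (k i).choose 2 * (1 / d i - μ i) := by
  have hd := fun i => one_div_natCast_le_one (d i)
  rw [gap, expectedReward_eq_sum_meanDistinct (le_of_sum_le hstar),
    expectedReward_eq_sum_meanDistinct (le_of_sum_le hk.sum_eq.le)]
  calc ∑ i, meanDistinct (1 / d i) (kstar i) - ∑ i, meanDistinct (1 / d i) (k i)
      ≤ ∑ i, meanDistinct (μ i) (kstar i) - ∑ i, meanDistinct (1 / d i) (k i) := by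
        gcongr with i
        exact meanDistinct_antitone (hμ i) (hd i) _
    _ ≤ ∑ i, meanDistinct (μ i) (k i) - ∑ i, meanDistinct (1 / d i) (k i) :=
        sub_le_sub_right (hk.sum_meanDistinct_le hμ0 (fun i => (hμ i).trans (hd i)) hstar) _
    _ ≤ ∑ i, (k i).choose 2 * (1 / d i - μ i) := by
        rw [← Finset.sum_sub_distrib]
        exact Finset.sum_le_sum fun i _ =>
          meanDistinct_sub_meanDistinct_le (hμ0 i) (hμ i) (hd i) _

end Gaps

section Charging

variable {m K : ℕ} {d kstar : Fin m → ℕ} {σ : LearnerState m} {t : ℕ}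

theorem IsAccurate.lcb_le (h : IsAccurate d σ t) (hzero : ∀ i, σ.count i = 0 → σ.mean i = 0)
    (i : Fin m) : σ.lcb t i ≤ 1 / d i := by
  refine max_le (by positivity) ?_
  rcases (σ.count i).eq_zero_or_pos with hcount | hcount
  · rw [hzero i hcount, LearnerState.radius, if_pos hcount, sub_zero]
    positivity
  · linarith [(abs_le.1 (h i hcount)).2]

/-- A bound on the width of the confidence interval `[lcb, 1 / d]` after `n` observations, in any
round whose number has logarithm at most `L`. Without observations it is the trivial bound `1`. -/
noncomputable def confidenceWidth (L : ℝ) (n : ℕ) : ℝ :=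
  if n = 0 then 1 else √(6 * L / n)

theorem IsAccurate.one_div_sub_lcb_le (h : IsAccurate d σ t) {L : ℝ} (hL : Real.log t ≤ L)
    (i : Fin m) : 1 / d i - σ.lcb t i ≤ confidenceWidth L (σ.count i) := by
  rw [confidenceWidth]
  split_ifs with hcount
  · have hlcb : 0 ≤ σ.lcb t i := le_max_left _ _
    linarith [one_div_natCast_le_one (d i)]
  · have hlcb : σ.mean i - σ.radius t i ≤ σ.lcb t i := le_max_right _ _
    calc 1 / d i - σ.lcb t i ≤ 2 * σ.radius t i := by
          linarith [(abs_le.1 (h i (Nat.pos_of_ne_zero hcount))).1]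
      _ = √(2 ^ 2 * (3 * Real.log t / (2 * σ.count i))) := by
          rw [LearnerState.radius, if_neg hcount, Real.sqrt_mul (by positivity),
            Real.sqrt_sq zero_le_two]
      _ = √(6 * Real.log t / σ.count i) := by
          congr 1
          field_simp
          ring
      _ ≤ √(6 * L / σ.count i) := by gcongr

/-- The part of the gap of a round that is charged to a community with `n` observations and
smallest gap `Δ`. Since `B` bounds the sensitivity of the reward, a round of gap at least `Δ` needs
a community with `2 * B * confidenceWidth L n` above `Δ`. Nothing is charged if `Δ = ⊤`. -/
noncomputable def charge (B L : ℝ) (Δ : EReal) (n : ℕ) : ℝ :=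
  if Δ = ⊤ then 0 else max 0 (2 * B * confidenceWidth L n - Δ.toReal)

theorem charge_nonneg (B L : ℝ) (Δ : EReal) (n : ℕ) : 0 ≤ charge B L Δ n := by
  rw [charge]
  split_ifs
  exacts [le_rfl, le_max_left _ _]

theorem sum_max_confidenceWidth_sub_le {B L M : ℝ} (hB : 0 ≤ B) (hL : 0 ≤ L) (hM : 0 < M)
    (N : ℕ) :
    ∑ n ∈ Finset.range N, max 0 (2 * B * confidenceWidth L n - M) ≤
      24 * B ^ 2 * L / M + 2 * B := by
  cases N with
  | zero => simpa using by positivity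
  | succ N =>
    rw [Finset.sum_range_succ']
    refine add_le_add ?_ (max_le (by positivity) (by simpa [confidenceWidth] using hM.le))
    have hterm : ∀ n : ℕ, 2 * B * confidenceWidth L (n + 1) =
        2 * B * √(6 * L) / √((n + 1 : ℕ) : ℝ) := fun n => by
      rw [confidenceWidth, if_neg n.succ_ne_zero, Real.sqrt_div (by positivity), mul_div_assoc]
    simp only [hterm]
    refine (sum_max_div_sqrt_sub_le (by positivity) hM N).trans_eq ?_
    rw [mul_pow, Real.sq_sqrt (by positivity)]
    ring

/-- For `Δ = ⊤` the quotient is `0`, since `EReal.toReal ⊤ = 0`. -/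
theorem sum_charge_le {B L : ℝ} {Δ : EReal} (hB : 0 ≤ B) (hL : 0 ≤ L) (hΔ : 0 < Δ) (N : ℕ) :
    ∑ n ∈ Finset.range N, charge B L Δ n ≤ 24 * B ^ 2 * L / Δ.toReal + 2 * B := by
  by_cases htop : Δ = ⊤
  · simpa [charge, htop] using hB
  · simpa only [charge, if_neg htop] using
      sum_max_confidenceWidth_sub_le hB hL (EReal.toReal_pos hΔ htop) N

variable [∀ i, NeZero (d i)] {k : Fin m → ℕ} {B L : ℝ}

theorem gap_le_sum_charge (hacc : IsAccurate d σ t)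
    (hzero : ∀ i, σ.count i = 0 → σ.mean i = 0) (hL : Real.log t ≤ L)
    (hk : GreedyAllocation (σ.lcb t) K k) (hB : ∑ i, ((k i).choose 2 : ℝ) ≤ B)
    (hstar : ∑ i, kstar i ≤ K) :
    gap K d kstar k ≤
      ∑ i, if 1 < k i then charge B L (gapMin K d kstar i) (σ.count i) else 0 := by
  rcases le_or_gt (gap K d kstar k) 0 with hgap | hgap
  · refine hgap.trans (Finset.sum_nonneg fun i _ => ?_)
    split_ifs
    exacts [charge_nonneg _ _ _ _, le_rfl]
  have hwidth : gap K d kstar k ≤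
      ∑ i with 1 < k i, (k i).choose 2 * confidenceWidth L (σ.count i) := by
    rw [Finset.sum_filter_of_ne fun i _ hi => ?_]
    · refine (gap_le_sum_choose_two (fun i => le_max_left _ _) (hacc.lcb_le hzero) hk
        hstar).trans ?_
      gcongr with i
      exact hacc.one_div_sub_lcb_le hL i
    · contrapose! hi
      rw [Nat.choose_eq_zero_of_lt (by omega), Nat.cast_zero, zero_mul]
  have hB' : ∑ i with 1 < k i, ((k i).choose 2 : ℝ) ≤ B :=
    (Finset.sum_le_univ_sum_of_nonneg fun i => Nat.cast_nonneg _).trans hB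
  rw [← Finset.sum_filter]
  refine (le_sum_max_two_mul_sub (fun i _ => Nat.cast_nonneg _) hB' hgap.le hwidth).trans
    (Finset.sum_le_sum fun i hi => ?_)
  have hmin := gapMin_le_gap (i := i) ⟨hk.sum_eq, hgap, (Finset.mem_filter.1 hi).2⟩
  have hne_top : gapMin K d kstar i ≠ ⊤ := (hmin.trans_lt (EReal.coe_lt_top _)).ne
  rw [charge, if_neg hne_top]
  gcongr
  exact EReal.toReal_le_toReal hmin (gapMin_pos.trans' EReal.bot_lt_zero).ne' (EReal.coe_ne_top _)

end Charging

section Regret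

variable {m K : ℕ} {d : Fin m → ℕ} {Ω : Type*} {mΩ : MeasurableSpace Ω} {P : Measure Ω}
  {ℱ : Filtration ℕ mΩ} {Φ : ℕ → Ω → Realization K d} {k : ℕ → Ω → Fin m → ℕ}
  {kstar : Fin m → ℕ}

theorem reward_le (k : Fin m → ℕ) (φ : Realization K d) : reward k φ ≤ ∑ i, d i :=
  Finset.sum_le_sum fun _ _ => (Finset.card_le_univ _).trans_eq (Fintype.card_fin _)

theorem norm_reward_le (k : Fin m → ℕ) (φ : Realization K d) :
    ‖(reward k φ : ℝ)‖ ≤ (∑ i, d i : ℕ) := by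
  rw [Real.norm_natCast]
  exact_mod_cast reward_le k φ

theorem integrable_reward [IsFiniteMeasure P] {κ : Ω → Fin m → ℕ} (hκ : Measurable κ)
    {φ : Ω → Realization K d} (hφ : Measurable φ) :
    Integrable (fun ω => (reward (κ ω) (φ ω) : ℝ)) P :=
  .of_bound ((Measurable.of_discrete (f := fun p : (Fin m → ℕ) × Realization K d =>
    (reward p.1 p.2 : ℝ))).comp (hκ.prodMk hφ)).aestronglyMeasurable _
    (ae_of_all _ fun _ => norm_reward_le _ _)

theorem integral_reward_eq_integral_expectedReward [IsFiniteMeasure P]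
    (henv : IsOnlineEnvironment d P ℱ Φ) {t : ℕ} {κ : Ω → Fin m → ℕ} (hκ : Measurable[ℱ t] κ) :
    ∫ ω, (reward (κ ω) (Φ (t + 1) ω) : ℝ) ∂P = ∫ ω, expectedReward K d (κ ω) ∂P :=
  integral_comp_realization henv hκ (g := fun a φ => (reward a φ : ℝ))
    Measurable.of_discrete.stronglyMeasurable
    (integrable_reward (hκ.mono (ℱ.le t) le_rfl) ((henv.adapted t).mono (ℱ.le _) le_rfl))

variable [∀ i, NeZero (d i)]

theorem norm_expectedReward_le (k : Fin m → ℕ) : ‖expectedReward K d k‖ ≤ (∑ i, d i : ℕ) :=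
  (norm_integral_le_of_norm_le_const (ae_of_all _ (norm_reward_le k))).trans_eq (by simp)

theorem integrable_expectedReward [IsFiniteMeasure P] {κ : Ω → Fin m → ℕ} (hκ : Measurable κ) :
    Integrable (fun ω => expectedReward K d (κ ω)) P :=
  .of_bound ((Measurable.of_discrete (f := expectedReward K d)).comp hκ).aestronglyMeasurable _
    (ae_of_all _ fun _ => norm_expectedReward_le _)

variable [IsProbabilityMeasure P]

theorem integrable_gap (hk : ∀ t, Measurable[ℱ t] (k (t + 1))) (t : ℕ) :
    Integrable (fun ω => gap K d kstar (k (t + 1) ω)) P :=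
  (integrable_const _).sub (integrable_expectedReward ((hk t).mono (ℱ.le t) le_rfl))

theorem regret_eq_integral_sum_gap (henv : IsOnlineEnvironment d P ℱ Φ)
    (hk : ∀ t, Measurable[ℱ t] (k (t + 1))) (T : ℕ) :
    regret P Φ kstar k T = ∫ ω, ∑ t ∈ Finset.range T, gap K d kstar (k (t + 1) ω) ∂P := by
  have hΦ : ∀ t, Measurable (Φ (t + 1)) := fun t => (henv.adapted t).mono (ℱ.le _) le_rfl
  have hk' : ∀ t, Measurable (k (t + 1)) := fun t => (hk t).mono (ℱ.le t) le_rfl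
  have hstar : ∀ t, Integrable (fun ω => (reward kstar (Φ (t + 1) ω) : ℝ)) P := fun t =>
    integrable_reward measurable_const (hΦ t)
  have hplay : ∀ t, Integrable (fun ω => (reward (k (t + 1) ω) (Φ (t + 1) ω) : ℝ)) P := fun t =>
    integrable_reward (hk' t) (hΦ t)
  have hdiff : ∀ t, Integrable (fun ω => (reward kstar (Φ (t + 1) ω) : ℝ) -
      reward (k (t + 1) ω) (Φ (t + 1) ω)) P := fun t => (hstar t).sub (hplay t)
  have hreindex : ∀ f : ℕ → ℝ, ∑ t ∈ Finset.Icc 1 T, f t = ∑ t ∈ Finset.range T, f (t + 1) := by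
    intro f
    rw [Finset.range_eq_Ico, Finset.sum_Ico_add' f 0 T 1]
    rfl
  simp only [regret, hreindex]
  rw [integral_finsetSum _ fun t _ => hdiff t, integral_finsetSum _ fun t _ => integrable_gap hk t]
  refine Finset.sum_congr rfl fun t _ => ?_
  simp only [gap]
  rw [integral_sub (hstar t) (hplay t),
    integral_sub (integrable_const _) (integrable_expectedReward (hk' t)),
    integral_reward_eq_integral_expectedReward henv (measurable_const (a := kstar)),
    integral_reward_eq_integral_expectedReward henv (hk t)]

end Regret

section RegretBound

variable {m K : ℕ} {d : Fin m → ℕ} [∀ i, NeZero (d i)] {Ω : Type*} {mΩ : MeasurableSpace Ω}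
  {P : Measure Ω} {ℱ : Filtration ℕ mΩ} {Φ : ℕ → Ω → Realization K d} {k : ℕ → Ω → Fin m → ℕ}
  {kstar : Fin m → ℕ} {B : ℝ}

/-- The event that the confidence intervals used in round `t + 1` fail. -/
def inaccurateEvent (k : ℕ → Ω → Fin m → ℕ) (Φ : ℕ → Ω → Realization K d) (t : ℕ) : Set Ω :=
  {ω | ¬ IsAccurate d (stateProcess k Φ t ω) (t + 1)}

theorem gap_round_le (halg : IsRevisedCLCB ℱ Φ k) (hstar : ∑ i, kstar i ≤ K) {t T : ℕ}
    (ht : t < T) {ω : Ω} (hB : ∑ i, ((k (t + 1) ω i).choose 2 : ℝ) ≤ B) :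
    gap K d kstar (k (t + 1) ω) ≤
      (∑ i, if 1 < (feedback (k (t + 1) ω) (Φ (t + 1) ω) i).length then
        charge B (Real.log T) (gapMin K d kstar i) ((stateProcess k Φ t ω).count i) else 0) +
      (inaccurateEvent k Φ t).indicator (fun _ => gapMax K d kstar) ω := by
  have hsum := (halg.greedy t ω).sum_eq
  have hcharge : ∀ i, 0 ≤ if 1 < (feedback (k (t + 1) ω) (Φ (t + 1) ω) i).length then
      charge B (Real.log T) (gapMin K d kstar i) ((stateProcess k Φ t ω).count i) else 0 := by
    intro i
    split_ifs
    exacts [charge_nonneg _ _ _ _, le_rfl]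
  by_cases hacc : IsAccurate d (stateProcess k Φ t ω) (t + 1)
  · rw [Set.indicator_of_notMem (not_not.2 hacc), add_zero]
    simp only [length_feedback, min_eq_left (le_of_sum_le hsum.le _)]
    exact gap_le_sum_charge hacc (fun i => mean_stateAfter_of_count_eq_zero _ _ i)
      (Real.log_le_log (by positivity) (Nat.cast_le.2 ht)) (halg.greedy t ω) hB hstar
  · rw [Set.indicator_of_mem (show ω ∈ inaccurateEvent k Φ t from hacc)]
    refine le_add_of_nonneg_of_le (Finset.sum_nonneg fun i _ => hcharge i) ?_
    rcases le_or_gt (gap K d kstar (k (t + 1) ω)) 0 with hgap | hgap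
    · exact hgap.trans gapMax_nonneg
    · obtain ⟨i, hi⟩ := exists_mem_badActions hsum hstar hgap
      exact gap_le_gapMax hi

theorem sum_gap_le (halg : IsRevisedCLCB ℱ Φ k) (hstar : ∑ i, kstar i ≤ K) (hB0 : 0 ≤ B)
    (hB : ∀ t ω, ∑ i, ((k (t + 1) ω i).choose 2 : ℝ) ≤ B) {T : ℕ} (hT : 1 ≤ T) (ω : Ω) :
    ∑ t ∈ Finset.range T, gap K d kstar (k (t + 1) ω) ≤
      ∑ i, (24 * B ^ 2 * Real.log T / (gapMin K d kstar i).toReal + 2 * B) +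
      ∑ t ∈ Finset.range T,
        (inaccurateEvent k Φ t).indicator (fun _ => gapMax K d kstar) ω := by
  refine (Finset.sum_le_sum fun t ht =>
    gap_round_le halg hstar (Finset.mem_range.1 ht) (hB t ω)).trans ?_
  rw [Finset.sum_add_distrib, Finset.sum_comm]
  gcongr with i
  refine (sum_ite_comp_count_stateAfter (fun s => k s ω) (fun s => Φ s ω) i
    (charge B (Real.log T) (gapMin K d kstar i)) T).trans_le ?_
  exact sum_charge_le hB0 (Real.log_nonneg (Nat.one_le_cast.2 hT)) gapMin_pos _

variable [IsProbabilityMeasure P]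

theorem sum_measureReal_inaccurateEvent_le (henv : IsOnlineEnvironment d P ℱ Φ)
    (hk : ∀ t, Measurable[ℱ t] (k (t + 1))) (T : ℕ) :
    ∑ t ∈ Finset.range T, P.real (inaccurateEvent k Φ t) ≤ Real.pi ^ 2 / 3 * m :=
  calc ∑ t ∈ Finset.range T, P.real (inaccurateEvent k Φ t)
      ≤ ∑ t ∈ Finset.range T, 2 * m * (1 / ((t + 1 : ℕ) : ℝ) ^ 2) :=
        Finset.sum_le_sum fun t _ => measureReal_not_isAccurate_le henv hk t
    _ ≤ 2 * m * (Real.pi ^ 2 / 6) := by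
        rw [← Finset.mul_sum]
        gcongr
        exact sum_one_div_sq_le T
    _ = Real.pi ^ 2 / 3 * m := by ring

theorem regret_le (henv : IsOnlineEnvironment d P ℱ Φ) (halg : IsRevisedCLCB ℱ Φ k)
    (hstar : ∑ i, kstar i ≤ K) (hB0 : 0 ≤ B)
    (hB : ∀ t ω, ∑ i, ((k (t + 1) ω i).choose 2 : ℝ) ≤ B) {T : ℕ} (hT : 1 ≤ T) :
    regret P Φ kstar k T ≤ ∑ i, 24 * B ^ 2 * Real.log T / (gapMin K d kstar i).toReal +
      (2 * B * m + Real.pi ^ 2 / 3 * m * gapMax K d kstar) := by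
  have hk := halg.nonanticipating
  have hmeas : ∀ t, MeasurableSet (inaccurateEvent k Φ t) := fun t =>
    (measurableSet_isAccurate henv hk t (t + 1)).compl
  have hint : Integrable (fun ω => ∑ t ∈ Finset.range T,
      (inaccurateEvent k Φ t).indicator (fun _ => gapMax K d kstar) ω) P :=
    integrable_finsetSum _ fun t _ => (integrable_const _).indicator (hmeas t)
  calc regret P Φ kstar k T
      = ∫ ω, ∑ t ∈ Finset.range T, gap K d kstar (k (t + 1) ω) ∂P :=
        regret_eq_integral_sum_gap henv hk T
    _ ≤ ∫ ω, (∑ i, (24 * B ^ 2 * Real.log T / (gapMin K d kstar i).toReal + 2 * B) +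
          ∑ t ∈ Finset.range T,
            (inaccurateEvent k Φ t).indicator (fun _ => gapMax K d kstar) ω) ∂P :=
        integral_mono (integrable_finsetSum _ fun t _ => integrable_gap hk t)
          ((integrable_const _).add hint) (sum_gap_le halg hstar hB0 hB hT)
    _ = ∑ i, (24 * B ^ 2 * Real.log T / (gapMin K d kstar i).toReal + 2 * B) +
          (∑ t ∈ Finset.range T, P.real (inaccurateEvent k Φ t)) * gapMax K d kstar := by
        rw [integral_add (integrable_const _) hint,
          integral_finsetSum _ fun t _ => (integrable_const _).indicator (hmeas t)]
        simp only [integral_const, probReal_univ, one_mul, integral_indicator_const _ (hmeas _),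
          smul_eq_mul, Finset.sum_mul]
    _ ≤ ∑ i, (24 * B ^ 2 * Real.log T / (gapMin K d kstar i).toReal + 2 * B) +
          Real.pi ^ 2 / 3 * m * gapMax K d kstar := by
        gcongr
        · exact gapMax_nonneg
        · exact sum_measureReal_inaccurateEvent_le henv hk T
    _ = ∑ i, 24 * B ^ 2 * Real.log T / (gapMin K d kstar i).toReal +
          (2 * B * m + Real.pi ^ 2 / 3 * m * gapMax K d kstar) := by
        simp only [Finset.sum_add_distrib, Finset.sum_const, Finset.card_univ, Fintype.card_fin,
          nsmul_eq_mul]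
        ring

end RegretBound

theorem coe_sum_div_toReal {ι : Type*} (s : Finset ι) (c : ℝ) (x : ι → EReal) :
    ((∑ i ∈ s, c / (x i).toReal : ℝ) : EReal) = ∑ i ∈ s, (c : EReal) / x i := by
  have hdiv : ∀ y : EReal, ((c / y.toReal : ℝ) : EReal) = c / y := fun y => by
    induction y <;> simp [EReal.coe_div]
  exact (map_sum (⟨⟨Real.toEReal, EReal.coe_zero⟩, EReal.coe_add⟩ : ℝ →+ EReal) _ s).trans
    (Finset.sum_congr rfl fun i _ => hdiv (x i))

end CommunityExploration

open CommunityExploration in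
theorem mainTheorem7_general {m K : ℕ} (d : Fin m → ℕ) (hd : ∀ i, 0 < d i)
    {Ω : Type*} {mΩ : MeasurableSpace Ω} (P : Measure Ω) [IsProbabilityMeasure P]
    (ℱ : Filtration ℕ mΩ) (Φ : ℕ → Ω → Realization K d) (k : ℕ → Ω → Fin m → ℕ)
    (henv : IsOnlineEnvironment d P ℱ Φ) (halg : IsRevisedCLCB ℱ Φ k)
    (kstar : Fin m → ℕ) (hstar : ∑ i, kstar i ≤ K) (T : ℕ) (hT : 1 ≤ T) :
    ((regret P Φ kstar k T : ℝ) : EReal) ≤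
      (∑ i : Fin m, ((24 * (((K - m + 1).choose 2 : ℕ) : ℝ) ^ 2 * Real.log T : ℝ) : EReal) /
          gapMin K d kstar i) +
      ((2 * (((K - m + 1).choose 2 : ℕ) : ℝ) * m +
        Real.pi ^ 2 / 3 * m * gapMax K d kstar : ℝ) : EReal) := by
  have : ∀ i, NeZero (d i) := fun i => NeZero.of_pos (hd i)
  have hsensitivity : ∀ t ω, ∑ i, ((k (t + 1) ω i).choose 2 : ℝ) ≤ (K - m + 1).choose 2 := by
    intro t ω
    have h := sum_choose_two_le (halg.explores t ω)
    rw [(halg.greedy t ω).sum_eq, Fintype.card_fin] at h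
    exact_mod_cast h
  rw [← coe_sum_div_toReal, ← EReal.coe_add, EReal.coe_le_coe_iff]
  exact regret_le henv halg hstar (Nat.cast_nonneg _) hsensitivity hT

theorem mainTheorem7 {m K : ℕ} (hmK : m < K) (d : Fin m → ℕ) (hd : ∀ i, 0 < d i)
    {Ω : Type*} {mΩ : MeasurableSpace Ω} (P : Measure Ω) [IsProbabilityMeasure P]
    (ℱ : Filtration ℕ mΩ) (Φ : ℕ → Ω → CommunityExploration.Realization K d)
    (k : ℕ → Ω → Fin m → ℕ)
    (henv : CommunityExploration.IsOnlineEnvironment d P ℱ Φ)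
    (halg : CommunityExploration.IsRevisedCLCB ℱ Φ k)
    (kstar : Fin m → ℕ) (hopt : CommunityExploration.IsOptimalAllocation K d kstar)
    (T : ℕ) (hT : 1 ≤ T) :
    ((CommunityExploration.regret P Φ kstar k T : ℝ) : EReal) ≤
      (∑ i : Fin m,
        ((48 * (((K - m + 1).choose 2 : ℕ) : ℝ) ^ 2 * Real.log T : ℝ) : EReal) /
          CommunityExploration.gapMin K d kstar i) +
      ((2 * (((K - m + 1).choose 2 : ℕ) : ℝ) * m +
        Real.pi ^ 2 / 3 * m * CommunityExploration.gapMax K d kstar : ℝ) : EReal) := by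
  refine (mainTheorem7_general d hd P ℱ Φ k henv halg kstar hopt.1 T hT).trans ?_
  gcongr
  · exact CommunityExploration.gapMin_pos.le
  · norm_num
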